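/- Let $(\Omega,\mathcal B(\Omega),P)$ be an atomless standard Borel probability space. Let $\mathbf W\subset L_1(\Omega^2,P\otimes P)$ be the set of (almost-everywhere equivalence classes of) symmetric measurable functions $w:\Omega^2\to[0,1]$, equipped with the $L_1$-metric $d_1$. For $f\in L_1(\Omega^2)$ put $$\|f\|_\square=\sup_{S,T\in\mathcal B(\Omega)}\Bigl|\int_{S\times T}f(s,t)\,dP(s)\,dP(t)\Bigr| ,$$ and for $w,w'\in\mathbf W$ put $$\delta_\square(w,w')=\inf_\psi\|w^\psi-w'\|_\square,\qquad w^\psi(x,y)=w(\psi(x),\psi(y)),$$ where $\psi$ runs over all invertible measure-preserving transformations of $\Omega$ (bijections, measurable in both directions, with $\psi P=P$). Then $\delta_\square$ is a pseudometric; write $w\equiv w'$ if $\delta_\square(w,w')=0$ (weak isomorphy), let $\widehat{\mathbf W}=\mathbf W/{\equiv}$ be the quotient space, with the metric induced by $\delta_\square$, and for $\widehat w\in\widehat{\mathbf W}$ let $[\widehat w]_\square\subset\mathbf W$ be the corresponding equivalence class. **Theorem.** There is a sequence $(\xi_n)_{n\in\mathbb N}$ of Borel-measurable mappings $\xi_n:(\widehat{\mathbf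 W},\delta_\square)\to(\mathbf W,d_1)$ such that, for every $\widehat w\in\widehat{\mathbf W}$, the set $\{\xi_n(\widehat w)\mid n\in\mathbb N\}$ is a $d_1$-dense subset of $[\widehat w]_\square$. In particular, there is a Borel-measurable mapping $\xi:(\widehat{\mathbf W},\delta_\square)\to(\mathbf W,d_1)$ with $\xi(\widehat w)\in[\widehat w]_\square$ for all $\widehat w\in\widehat{\mathbf W}$. -/

import Mathlib

open MeasureTheory Set

/-- The invertible measure-preserving transformations of `(Ω, P)`. -/
abbrev MPAut {Ω : Type*} [MeasurableSpace Ω] (P : Measure Ω) : Type _ :=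
  {ψ : Ω ≃ᵐ Ω // MeasurePreserving ψ P P}

/-- The set of symmetric measurable functions `Ω × Ω → [0,1]`, as a subset of
`L¹(Ω × Ω)` (that is, up to almost everywhere equality). -/
def graphonSet {Ω : Type*} [MeasurableSpace Ω] (P : Measure Ω) : Set (Lp ℝ 1 (P.prod P)) :=
  {f | ∃ w : Ω × Ω → ℝ, Measurable w ∧ (∀ x y, w (x, y) = w (y, x)) ∧
      (∀ z, w z ∈ Icc (0 : ℝ) 1) ∧ f =ᵐ[P.prod P] w}

/-- The space `W`, which carries the metric `d₁` of `L¹(Ω × Ω)`. -/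
abbrev Graphon {Ω : Type*} [MeasurableSpace Ω] (P : Measure Ω) : Type _ :=
  ↥(graphonSet P)

namespace Graphon

variable {Ω : Type*} [MeasurableSpace Ω] {P : Measure Ω}

/-- The Borel σ-algebra of `(W, d₁)`. -/
noncomputable instance : MeasurableSpace (Graphon P) := borel (Graphon P)

instance : BorelSpace (Graphon P) := ⟨rfl⟩

/-- The cut norm `sup_{S,T} |∫_{S × T} f|` on `L¹(Ω × Ω)`. -/
noncomputable def cutNorm (f : Lp ℝ 1 (P.prod P)) : ℝ :=
  sSup {r : ℝ | ∃ S T : Set Ω, MeasurableSet S ∧ MeasurableSet T ∧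
    r = |∫ z in S ×ˢ T, f z ∂(P.prod P)|}

lemma measurePreserving_prodMap [SFinite P] (ψ : MPAut P) :
    MeasurePreserving (Prod.map ψ.1 ψ.1) (P.prod P) (P.prod P) :=
  ψ.2.prod ψ.2

/-- `f^ψ (x, y) = f (ψ x, ψ y)`. -/
noncomputable def pullback [SFinite P] (ψ : MPAut P) (f : Lp ℝ 1 (P.prod P)) :
    Lp ℝ 1 (P.prod P) :=
  Lp.compMeasurePreserving (Prod.map ψ.1 ψ.1) (measurePreserving_prodMap ψ) f

/-- The cut distance `δ□(w, w') = inf_ψ ‖w^ψ - w'‖□`, over all invertible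
measure-preserving transformations `ψ`. -/
noncomputable def cutDist [SFinite P] (w w' : Graphon P) : ℝ :=
  ⨅ ψ : MPAut P, cutNorm (pullback ψ w.1 - w'.1)

/-! Facts showing that `cutDist` is a pseudometric. -/

lemma abs_setIntegral_le (f : Lp ℝ 1 (P.prod P)) (A : Set (Ω × Ω)) :
    |∫ z in A, f z ∂(P.prod P)| ≤ ∫ z, |f z| ∂(P.prod P) := by
  have hf : Integrable f (P.prod P) := L1.integrable_coeFn f
  refine (abs_integral_le_integral_abs).trans ?_
  exact setIntegral_le_integral hf.abs (Filter.Eventually.of_forall fun z => abs_nonneg _)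

lemma cutNorm_bddAbove (f : Lp ℝ 1 (P.prod P)) :
    BddAbove {r : ℝ | ∃ S T : Set Ω, MeasurableSet S ∧ MeasurableSet T ∧
      r = |∫ z in S ×ˢ T, f z ∂(P.prod P)|} := by
  refine ⟨∫ z, |f z| ∂(P.prod P), ?_⟩
  rintro r ⟨S, T, -, -, rfl⟩
  exact abs_setIntegral_le f _

lemma le_cutNorm (f : Lp ℝ 1 (P.prod P)) {S T : Set Ω} (hS : MeasurableSet S)
    (hT : MeasurableSet T) : |∫ z in S ×ˢ T, f z ∂(P.prod P)| ≤ cutNorm f :=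
  le_csSup (cutNorm_bddAbove f) ⟨S, T, hS, hT, rfl⟩

lemma cutNorm_le {f : Lp ℝ 1 (P.prod P)} {c : ℝ}
    (h : ∀ S T : Set Ω, MeasurableSet S → MeasurableSet T →
      |∫ z in S ×ˢ T, f z ∂(P.prod P)| ≤ c) : cutNorm f ≤ c := by
  refine csSup_le ⟨_, ∅, ∅, MeasurableSet.empty, MeasurableSet.empty, rfl⟩ ?_
  rintro r ⟨S, T, hS, hT, rfl⟩
  exact h S T hS hT

lemma cutNorm_nonneg (f : Lp ℝ 1 (P.prod P)) : 0 ≤ cutNorm f :=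
  (abs_nonneg _).trans (le_cutNorm f MeasurableSet.empty MeasurableSet.empty)

lemma cutNorm_zero : cutNorm (0 : Lp ℝ 1 (P.prod P)) = 0 := by
  refine le_antisymm (cutNorm_le fun S T _ _ => ?_) (cutNorm_nonneg _)
  refine (abs_setIntegral_le _ _).trans (le_of_eq ?_)
  refine integral_eq_zero_of_ae ?_
  filter_upwards [Lp.coeFn_zero ℝ 1 (P.prod P)] with z hz
  rw [hz]
  simp

lemma cutNorm_add_le (f g : Lp ℝ 1 (P.prod P)) :
    cutNorm (f + g) ≤ cutNorm f + cutNorm g := by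
  refine cutNorm_le fun S T hS hT => ?_
  have hf : Integrable f (P.prod P) := L1.integrable_coeFn f
  have hg : Integrable g (P.prod P) := L1.integrable_coeFn g
  have h : ∫ z in S ×ˢ T, (f + g : Lp ℝ 1 (P.prod P)) z ∂(P.prod P)
      = (∫ z in S ×ˢ T, f z ∂(P.prod P)) + ∫ z in S ×ˢ T, g z ∂(P.prod P) := by
    rw [← integral_add hf.integrableOn hg.integrableOn]
    exact integral_congr_ae (ae_restrict_of_ae (Lp.coeFn_add f g))
  rw [h]
  exact (abs_add_le _ _).trans (add_le_add (le_cutNorm f hS hT) (le_cutNorm g hS hT))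

lemma cutNorm_neg_le (f : Lp ℝ 1 (P.prod P)) : cutNorm (-f) ≤ cutNorm f := by
  refine cutNorm_le fun S T hS hT => ?_
  have h : ∫ z in S ×ˢ T, (-f : Lp ℝ 1 (P.prod P)) z ∂(P.prod P)
      = -∫ z in S ×ˢ T, f z ∂(P.prod P) := by
    rw [← integral_neg]
    exact integral_congr_ae (ae_restrict_of_ae (Lp.coeFn_neg f))
  rw [h, abs_neg]
  exact le_cutNorm f hS hT

section

variable [SFinite P]

lemma coeFn_pullback (ψ : MPAut P) (f : Lp ℝ 1 (P.prod P)) :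
    pullback ψ f =ᵐ[P.prod P] f ∘ Prod.map ψ.1 ψ.1 :=
  Lp.coeFn_compMeasurePreserving f (measurePreserving_prodMap ψ)

lemma pullback_sub (ψ : MPAut P) (f g : Lp ℝ 1 (P.prod P)) :
    pullback ψ (f - g) = pullback ψ f - pullback ψ g :=
  map_sub (Lp.compMeasurePreserving (Prod.map ψ.1 ψ.1) (measurePreserving_prodMap ψ)) f g

/-- The identity, as an element of `MPAut P`. -/
def mpId (P : Measure Ω) : MPAut P := ⟨MeasurableEquiv.refl Ω, MeasurePreserving.id P⟩

/-- The inverse transformation. -/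
def mpSymm (ψ : MPAut P) : MPAut P := ⟨ψ.1.symm, ψ.2.symm⟩

/-- The composition `x ↦ φ (ψ x)`. -/
def mpComp (φ ψ : MPAut P) : MPAut P := ⟨ψ.1.trans φ.1, φ.2.comp ψ.2⟩

instance : Nonempty (MPAut P) := ⟨mpId P⟩

lemma pullback_id (f : Lp ℝ 1 (P.prod P)) : pullback (mpId P) f = f := by
  refine Lp.ext ?_
  filter_upwards [coeFn_pullback (mpId P) f] with z hz
  exact hz

lemma pullback_pullback (φ ψ : MPAut P) (f : Lp ℝ 1 (P.prod P)) :
    pullback ψ (pullback φ f) = pullback (mpComp φ ψ) f := by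
  refine Lp.ext ?_
  have h := (measurePreserving_prodMap ψ).quasiMeasurePreserving.ae (coeFn_pullback φ f)
  filter_upwards [coeFn_pullback ψ (pullback φ f), coeFn_pullback (mpComp φ ψ) f, h]
    with z h1 h2 h3
  rw [h1, h2, Function.comp_apply, h3]
  rfl

lemma pullback_symm_pullback (ψ : MPAut P) (f : Lp ℝ 1 (P.prod P)) :
    pullback ψ (pullback (mpSymm ψ) f) = f := by
  rw [pullback_pullback]
  convert pullback_id f
  refine Subtype.ext (MeasurableEquiv.ext (funext fun x => ?_))
  exact ψ.1.symm_apply_apply x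

lemma cutNorm_pullback_le (ψ : MPAut P) (f : Lp ℝ 1 (P.prod P)) :
    cutNorm (pullback ψ f) ≤ cutNorm f := by
  refine cutNorm_le fun S T hS hT => ?_
  have h : ∫ z in S ×ˢ T, pullback ψ f z ∂(P.prod P)
      = ∫ z in (ψ.1.symm ⁻¹' S) ×ˢ (ψ.1.symm ⁻¹' T), f z ∂(P.prod P) := by
    have hset : Prod.map ψ.1 ψ.1 ⁻¹' ((ψ.1.symm ⁻¹' S) ×ˢ (ψ.1.symm ⁻¹' T)) = S ×ˢ T := by
      ext z
      simp
    rw [← (measurePreserving_prodMap ψ).setIntegral_preimage_emb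
      (ψ.1.prodCongr ψ.1).measurableEmbedding f, hset]
    exact integral_congr_ae (ae_restrict_of_ae (coeFn_pullback ψ f))
  rw [h]
  exact le_cutNorm f (ψ.1.symm.measurable hS) (ψ.1.symm.measurable hT)

lemma cutDist_le (w w' : Graphon P) (ψ : MPAut P) :
    cutDist w w' ≤ cutNorm (pullback ψ w.1 - w'.1) :=
  ciInf_le ⟨0, by rintro _ ⟨φ, rfl⟩; exact cutNorm_nonneg _⟩ ψ

lemma cutDist_nonneg (w w' : Graphon P) : 0 ≤ cutDist w w' :=
  le_ciInf fun _ => cutNorm_nonneg _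

lemma cutDist_self (w : Graphon P) : cutDist w w = 0 := by
  refine le_antisymm ?_ (cutDist_nonneg w w)
  have h := cutDist_le w w (mpId P)
  rwa [pullback_id, sub_self, cutNorm_zero] at h

lemma cutDist_comm_le (w w' : Graphon P) : cutDist w w' ≤ cutDist w' w := by
  refine le_ciInf fun ψ => (cutDist_le w w' (mpSymm ψ)).trans ?_
  have h : pullback (mpSymm ψ) w.1 - w'.1
      = pullback (mpSymm ψ) (-(pullback ψ w'.1 - w.1)) := by
    rw [neg_sub, pullback_sub]
    congr 1
    exact (pullback_symm_pullback (mpSymm ψ) w'.1).symm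
  rw [h]
  exact (cutNorm_pullback_le _ _).trans (cutNorm_neg_le _)

lemma cutDist_comm (w w' : Graphon P) : cutDist w w' = cutDist w' w :=
  le_antisymm (cutDist_comm_le w w') (cutDist_comm_le w' w)

lemma cutDist_triangle (u v w : Graphon P) : cutDist u w ≤ cutDist u v + cutDist v w := by
  refine le_ciInf_add_ciInf fun φ ψ => (cutDist_le u w (mpComp φ ψ)).trans ?_
  have h : pullback (mpComp φ ψ) u.1 - w.1
      = pullback ψ (pullback φ u.1 - v.1) + (pullback ψ v.1 - w.1) := by
    rw [pullback_sub, pullback_pullback]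
    abel
  rw [h]
  exact (cutNorm_add_le _ _).trans (add_le_add (cutNorm_pullback_le _ _) le_rfl)

variable (P) in
/-- Weak isomorphy: `w ≡ w'` if and only if `δ□(w, w') = 0`. -/
def weakIso : Setoid (Graphon P) where
  r w w' := cutDist w w' = 0
  iseqv :=
    { refl := cutDist_self
      symm := fun {w w'} h => (cutDist_comm w' w).trans h
      trans := fun {u v w} h h' => le_antisymm
        ((cutDist_triangle u v w).trans (by rw [h, h', add_zero])) (cutDist_nonneg u w) }

end

end Graphon

/-- The quotient space `Ŵ` of `W` by weak isomorphy. -/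
def GraphonClass {Ω : Type*} [MeasurableSpace Ω] (P : Measure Ω) [SFinite P] : Type _ :=
  Quotient (Graphon.weakIso P)

namespace GraphonClass

variable {Ω : Type*} [MeasurableSpace Ω] {P : Measure Ω} [SFinite P]

/-- The canonical projection `W → Ŵ`. -/
def mk (w : Graphon P) : GraphonClass P := Quotient.mk (Graphon.weakIso P) w

/-- The metric on `Ŵ` given by `δ□`. -/
noncomputable instance : MetricSpace (GraphonClass P) where
  dist := Quotient.lift₂ Graphon.cutDist (by
    intro a b a' b' (h : Graphon.cutDist a a' = 0) (h' : Graphon.cutDist b b' = 0)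
    have h1 := Graphon.cutDist_triangle a a' b
    have h2 := Graphon.cutDist_triangle a' b' b
    have h3 := Graphon.cutDist_triangle a' a b'
    have h4 := Graphon.cutDist_triangle a b b'
    have h5 := Graphon.cutDist_comm a a'
    have h6 := Graphon.cutDist_comm b b'
    linarith)
  dist_self := by
    rintro ⟨a⟩
    exact Graphon.cutDist_self a
  dist_comm := by
    rintro ⟨a⟩ ⟨b⟩
    exact Graphon.cutDist_comm a b
  dist_triangle := by
    rintro ⟨a⟩ ⟨b⟩ ⟨c⟩
    exact Graphon.cutDist_triangle a b c
  eq_of_dist_eq_zero := by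
    rintro ⟨a⟩ ⟨b⟩ h
    exact Quotient.sound (s := Graphon.weakIso P) h

/-- The Borel σ-algebra of `(Ŵ, δ□)`. -/
noncomputable instance : MeasurableSpace (GraphonClass P) := borel (GraphonClass P)

instance : BorelSpace (GraphonClass P) := ⟨rfl⟩

/-- The equivalence class `[ŵ] ⊆ W` corresponding to a point `ŵ` of the quotient. -/
def eqvClass (c : GraphonClass P) : Set (Graphon P) := {w | mk w = c}

end GraphonClass

/-!
The theorem is a measurable selection statement for the fibres of the quotient map `W → Ŵ`, which
is a continuous surjection from the Polish space `(W, d₁)`. The fibres are closed, so the argument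
of Kuratowski and Ryll-Nardzewski (`exists_seq_measurable_selection`) yields a dense sequence of
measurable selections as soon as `{c | c.eqvClass ∩ U ≠ ∅}` is Borel for every `d₁`-ball `U`.

A subset of `Ŵ` is Borel if its preimage in `W` is, since `W` is standard Borel (a form of Souslin's
separation theorem). The preimage in question is the saturation of `U` under weak isomorphy, and it
is open: it is the union of the sets `U^ψ`, over all invertible measure-preserving `ψ`
(`GraphonClass.isOpen_preimage_image_ball`). This rests on the fact that `δ□(w, w') = 0` implies
`inf_ψ ‖w^ψ - w'‖₁ = 0` (`Graphon.exists_dist_pullback_lt`). To see that, put `f = w^ψ - w'`, which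
has `|f| ≤ 1`, and write `∫ f² = ∫ f^{ψ⁻¹} w - ∫ f w'`. Pairing with a fixed integrable kernel `h`
is controlled by the cut norm uniformly over `|f| ≤ 1` (`Graphon.CutControlled.of_integrable`),
because `h` is an `L¹`-limit of linear combinations of indicators of rectangles. As
`‖f^{ψ⁻¹}‖□ ≤ ‖f‖□`, a small cut norm of `f` forces a small `∫ f²`, hence a small `∫ |f|`.
-/

/-! ### Measurable selection from set-valued maps -/

section Selection

open Filter Topology

variable {X Y : Type*} [MetricSpace X] [MeasurableSpace Y]

/-- Successive approximation: from an index function `f₀` whose values `u (f₀ y)` are within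
`(1/2)^m` of `F y`, one obtains a measurable selection of `F` that stays close to `u ∘ f₀`. -/
lemma exists_measurable_selection_near [CompleteSpace X] [MeasurableSpace X] [BorelSpace X]
    {u : ℕ → X} (hu : DenseRange u) {F : Y → Set X} (hclosed : ∀ y, IsClosed (F y))
    (hmeas : ∀ (x : X) (r : ℝ), MeasurableSet {y | ∃ p ∈ F y, dist x p < r})
    (m : ℕ) {f₀ : Y → ℕ} (hf₀ : Measurable f₀)
    (h₀ : ∀ y, ∃ p ∈ F y, dist (u (f₀ y)) p < (1 / 2) ^ m) :
    ∃ ξ : Y → X, Measurable ξ ∧ ∀ y, ξ y ∈ F y ∧ dist (u (f₀ y)) (ξ y) ≤ 4 * (1 / 2) ^ m := by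
  classical
  -- One refinement step: halve the distance to `F y` while moving by at most twice that distance.
  have step : ∀ (n : ℕ) (f : Y → ℕ), Measurable f →
      (∀ y, ∃ p ∈ F y, dist (u (f y)) p < (1 / 2) ^ n) →
      ∃ g : Y → ℕ, Measurable g ∧ (∀ y, ∃ p ∈ F y, dist (u (g y)) p < (1 / 2) ^ (n + 1)) ∧
        ∀ y, dist (u (f y)) (u (g y)) < 2 * (1 / 2) ^ n := by
    intro n f hf h
    have hex : ∀ y, ∃ j, (∃ p ∈ F y, dist (u j) p < (1 / 2) ^ (n + 1)) ∧
        dist (u (f y)) (u j) < 2 * (1 / 2) ^ n := by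
      intro y
      obtain ⟨p, hp, hd⟩ := h y
      obtain ⟨j, hj⟩ := hu.exists_dist_lt p (ε := (1 / 2 : ℝ) ^ (n + 1)) (by positivity)
      refine ⟨j, ⟨p, hp, by rwa [dist_comm]⟩, (dist_triangle _ p _).trans_lt ?_⟩
      have : (1 / 2 : ℝ) ^ (n + 1) ≤ (1 / 2) ^ n :=
        pow_le_pow_of_le_one (by norm_num) (by norm_num) n.le_succ
      linarith
    refine ⟨fun y => Nat.find (hex y), measurable_find hex fun k => ?_,
      fun y => (Nat.find_spec (hex y)).1, fun y => (Nat.find_spec (hex y)).2⟩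
    exact (hmeas _ _).inter
      (hf (MeasurableSet.of_discrete (s := {i | dist (u i) (u k) < 2 * (1 / 2) ^ n})))
  let S : ℕ → Type _ := fun n =>
    {f : Y → ℕ // Measurable f ∧ ∀ y, ∃ p ∈ F y, dist (u (f y)) p < (1 / 2) ^ (m + n)}
  let next : ∀ n, S n → S (n + 1) := fun n f =>
    ⟨(step (m + n) f.1 f.2.1 f.2.2).choose,
      (step (m + n) f.1 f.2.1 f.2.2).choose_spec.1,
      (step (m + n) f.1 f.2.1 f.2.2).choose_spec.2.1⟩
  let s : ∀ n, S n := fun n => Nat.rec ⟨f₀, hf₀, h₀⟩ next n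
  have hs : ∀ n y, dist (u ((s n).1 y)) (u ((s (n + 1)).1 y)) ≤ 4 * (1 / 2) ^ m / 2 / 2 ^ n := by
    intro n y
    refine ((step (m + n) (s n).1 (s n).2.1 (s n).2.2).choose_spec.2.2 y).le.trans (le_of_eq ?_)
    rw [pow_add, one_div_pow 2 n]
    ring
  have hcauchy : ∀ y, CauchySeq fun n => u ((s n).1 y) := fun y =>
    cauchySeq_of_le_geometric_two (fun n => hs n y)
  choose ξ hξ using fun y => cauchySeq_tendsto_of_complete (hcauchy y)
  refine ⟨ξ, measurable_of_tendsto_metrizable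
    (fun n => (Measurable.of_discrete (f := u)).comp (s n).2.1) (tendsto_pi_nhds.2 hξ),
    fun y => ⟨?_, dist_le_of_le_geometric_two_of_tendsto₀ (fun n => hs n y) (hξ y)⟩⟩
  have hclose : ∀ n, ∃ p ∈ F y, dist (u ((s n).1 y)) p < (1 / 2) ^ (m + n) :=
    fun n => (s n).2.2 y
  choose p hpF hp using hclose
  have hzero : Tendsto (fun n => (1 / 2 : ℝ) ^ (m + n)) atTop (𝓝 0) := by
    simp_rw [pow_add]
    simpa using (tendsto_pow_atTop_nhds_zero_of_lt_one (r := (1 / 2 : ℝ))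
      (by norm_num) (by norm_num)).const_mul ((1 / 2 : ℝ) ^ m)
  have hdist : Tendsto (fun n => dist (u ((s n).1 y)) (p n)) atTop (𝓝 0) :=
    squeeze_zero (fun n => dist_nonneg) (fun n => (hp n).le) hzero
  exact (hclosed y).mem_of_tendsto ((tendsto_iff_of_dist hdist).1 (hξ y))
    (Eventually.of_forall hpF)

/-- Castaing representation (the theorem of Kuratowski and Ryll-Nardzewski applied around each
point of a dense sequence): a weakly measurable map with nonempty closed values in a complete
separable metric space has a sequence of measurable selections that is dense in every value. -/
theorem exists_seq_measurable_selection [CompleteSpace X] [SecondCountableTopology X]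
    [MeasurableSpace X] [BorelSpace X] [Nonempty X] {F : Y → Set X}
    (hclosed : ∀ y, IsClosed (F y)) (hne : ∀ y, (F y).Nonempty)
    (hmeas : ∀ (x : X) (r : ℝ), MeasurableSet {y | ∃ p ∈ F y, dist x p < r}) :
    ∃ ξ : ℕ → Y → X, (∀ n, Measurable (ξ n)) ∧
      ∀ y, range (fun n => ξ n y) ⊆ F y ∧ F y ⊆ closure (range fun n => ξ n y) := by
  classical
  obtain ⟨u, hu⟩ := TopologicalSpace.exists_dense_seq X
  have key : ∀ k m : ℕ, ∃ ξ : Y → X, Measurable ξ ∧ ∀ y, ξ y ∈ F y ∧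
      ((∃ p ∈ F y, dist (u k) p < (1 / 2) ^ m) → dist (u k) (ξ y) ≤ 4 * (1 / 2) ^ m) := by
    intro k m
    -- Start at `u k` where it is close to `F y`, and anywhere close to `F y` otherwise.
    have hex : ∀ y, ∃ j, (∃ p ∈ F y, dist (u j) p < (1 / 2) ^ m) ∧
        (j = k ∨ ¬ ∃ p ∈ F y, dist (u k) p < (1 / 2) ^ m) := by
      intro y
      by_cases hk : ∃ p ∈ F y, dist (u k) p < (1 / 2) ^ m
      · exact ⟨k, hk, Or.inl rfl⟩
      · obtain ⟨p, hp⟩ := hne y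
        obtain ⟨j, hj⟩ := hu.exists_dist_lt p (ε := (1 / 2 : ℝ) ^ m) (by positivity)
        exact ⟨j, ⟨p, hp, by rwa [dist_comm]⟩, Or.inr hk⟩
    obtain ⟨ξ, hξ, h⟩ := exists_measurable_selection_near hu hclosed hmeas m
      (measurable_find hex fun j => (hmeas (u j) _).inter
        ((MeasurableSet.const (j = k)).union (hmeas (u k) _).compl))
      (fun y => (Nat.find_spec (hex y)).1)
    refine ⟨ξ, hξ, fun y => ⟨(h y).1, fun hk => ?_⟩⟩
    have hj := (Nat.find_spec (hex y)).2.resolve_right (not_not_intro hk)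
    have := (h y).2
    rwa [hj] at this
  choose ξ hξ h using key
  refine ⟨fun n => ξ n.unpair.1 n.unpair.2, fun n => hξ _ _, fun y => ⟨?_, fun p hp => ?_⟩⟩
  · rintro _ ⟨n, rfl⟩
    exact (h _ _ y).1
  · refine Metric.mem_closure_iff.2 fun ε hε => ?_
    obtain ⟨m, hm⟩ := exists_pow_lt_of_lt_one (show 0 < ε / 5 by positivity)
      (show (1 / 2 : ℝ) < 1 by norm_num)
    obtain ⟨k, hk⟩ := hu.exists_dist_lt p (ε := (1 / 2 : ℝ) ^ m) (by positivity)
    refine ⟨_, ⟨Nat.pair k m, rfl⟩, ?_⟩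
    have := (h k m y).2 ⟨p, hp, by rwa [dist_comm]⟩
    simp only [Nat.unpair_pair]
    linarith [dist_triangle p (u k) (ξ k m y)]

end Selection

namespace Graphon

open Filter Topology

variable {Ω : Type*} [MeasurableSpace Ω] {P : Measure Ω}

/-! ### The space of graphons is Polish -/

lemma isClosed_graphonSet [SFinite P] : IsClosed (graphonSet P) := by
  refine IsSeqClosed.isClosed fun F f hF hlim => ?_
  choose w hw hsymm hIcc hae using hF
  obtain ⟨ns, -, hns⟩ := (tendstoInMeasure_of_tendsto_Lp hlim).exists_seq_tendsto_ae
  -- The clamped pointwise `limsup` represents the limit and inherits symmetry everywhere.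
  refine ⟨fun z => max 0 (min 1 (limsup (fun n => w (ns n) z) atTop)),
    measurable_const.max (measurable_const.min (Measurable.limsup fun n => hw (ns n))),
    fun x y => by simp only [hsymm _ x y],
    fun z => ⟨le_max_left _ _, max_le zero_le_one (min_le_left _ _)⟩, ?_⟩
  filter_upwards [hns, ae_all_iff.2 fun n => hae (ns n)] with z hz hz'
  simp only [hz'] at hz
  have h0 : 0 ≤ f z := ge_of_tendsto' hz fun n => (hIcc (ns n) z).1
  have h1 : f z ≤ 1 := le_of_tendsto' hz fun n => (hIcc (ns n) z).2
  rw [hz.limsup_eq, min_eq_right h1, max_eq_right h0]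

instance [SFinite P] : CompleteSpace (Graphon P) :=
  isClosed_graphonSet.isComplete.completeSpace_coe

instance [StandardBorelSpace Ω] [SFinite P] : SecondCountableTopology (Graphon P) :=
  have : Fact ((1 : ENNReal) ≠ ⊤) := ⟨ENNReal.one_ne_top⟩
  TopologicalSpace.Subtype.secondCountableTopology _

instance : Nonempty (Graphon P) :=
  ⟨⟨0, 0, measurable_zero, fun _ _ => rfl, fun _ => ⟨le_rfl, zero_le_one⟩, Lp.coeFn_zero _ _ _⟩⟩

lemma ae_mem_Icc (w : Graphon P) : ∀ᵐ z ∂P.prod P, w.1 z ∈ Icc (0 : ℝ) 1 := by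
  obtain ⟨g, -, -, hg, h⟩ := w.2
  filter_upwards [h] with z hz
  rw [hz]
  exact hg z

lemma cutNorm_le_norm (f : Lp ℝ 1 (P.prod P)) : cutNorm f ≤ ‖f‖ := by
  rw [L1.norm_eq_integral_norm]
  exact cutNorm_le fun S T _ _ => abs_setIntegral_le f _

/-! ### Testing against a fixed integrable kernel -/

/-- The kernel `h` is cut-controlled if, over all `f` with `|f| ≤ 1`, the pairing `∫ f h` is small
whenever `‖f‖□` is small, uniformly in `f`. -/
def CutControlled (P : Measure Ω) (h : Ω × Ω → ℝ) : Prop :=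
  ∀ ε > 0, ∃ C, 0 ≤ C ∧ ∀ f : Lp ℝ 1 (P.prod P), (∀ᵐ z ∂P.prod P, |f z| ≤ 1) →
    |∫ z, f z * h z ∂P.prod P| ≤ C * cutNorm f + ε

lemma integrable_mul_of_abs_le_one {f : Lp ℝ 1 (P.prod P)} (hf : ∀ᵐ z ∂P.prod P, |f z| ≤ 1)
    {h : Ω × Ω → ℝ} (hh : Integrable h (P.prod P)) :
    Integrable (fun z => f z * h z) (P.prod P) :=
  hh.bdd_mul (Lp.aestronglyMeasurable f) hf

namespace CutControlled

variable {g h : Ω × Ω → ℝ}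

lemma congr (hg : CutControlled P g) (hgh : g =ᵐ[P.prod P] h) : CutControlled P h := by
  intro ε hε
  obtain ⟨C, hC, H⟩ := hg ε hε
  refine ⟨C, hC, fun f hf => ?_⟩
  rw [← integral_congr_ae (show (fun z => f z * g z) =ᵐ[P.prod P] fun z => f z * h z by
    filter_upwards [hgh] with z hz
    rw [hz])]
  exact H f hf

lemma add (hg : CutControlled P g) (hh : CutControlled P h) (hgi : Integrable g (P.prod P))
    (hhi : Integrable h (P.prod P)) : CutControlled P (g + h) := by
  intro ε hε
  obtain ⟨C, hC, H⟩ := hg (ε / 2) (half_pos hε)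
  obtain ⟨D, hD, K⟩ := hh (ε / 2) (half_pos hε)
  refine ⟨C + D, add_nonneg hC hD, fun f hf => ?_⟩
  simp only [Pi.add_apply, mul_add]
  rw [integral_add (integrable_mul_of_abs_le_one hf hgi) (integrable_mul_of_abs_le_one hf hhi)]
  refine (abs_add_le _ _).trans ((add_le_add (H f hf) (K f hf)).trans (le_of_eq ?_))
  ring

lemma const_mul (hg : CutControlled P g) (c : ℝ) : CutControlled P fun z => c * g z := by
  intro ε hε
  obtain ⟨C, hC, H⟩ := hg (ε / (|c| + 1)) (by positivity)
  refine ⟨|c| * C, by positivity, fun f hf => ?_⟩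
  simp only [mul_left_comm _ c]
  rw [integral_const_mul, abs_mul]
  refine (mul_le_mul_of_nonneg_left (H f hf) (abs_nonneg c)).trans ?_
  have : |c| * (ε / (|c| + 1)) ≤ ε := by
    rw [mul_div_assoc', div_le_iff₀ (by positivity)]
    nlinarith [abs_nonneg c]
  linarith

lemma of_approx (hhi : Integrable h (P.prod P))
    (H : ∀ ε > 0, ∃ g, Integrable g (P.prod P) ∧ CutControlled P g ∧
      ∫ z, |h z - g z| ∂P.prod P ≤ ε) : CutControlled P h := by
  intro ε hε
  obtain ⟨g, hgi, hg, hgε⟩ := H (ε / 2) (half_pos hε)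
  obtain ⟨C, hC, K⟩ := hg (ε / 2) (half_pos hε)
  refine ⟨C, hC, fun f hf => ?_⟩
  have hsplit : ∫ z, f z * h z ∂P.prod P
      = (∫ z, f z * g z ∂P.prod P) + ∫ z, f z * (h z - g z) ∂P.prod P := by
    rw [← integral_add (integrable_mul_of_abs_le_one hf hgi)
      (integrable_mul_of_abs_le_one (h := fun z => h z - g z) hf (hhi.sub hgi))]
    refine integral_congr_ae (Eventually.of_forall fun z => ?_)
    ring
  have hdiff : |∫ z, f z * (h z - g z) ∂P.prod P| ≤ ε / 2 := by
    refine abs_integral_le_integral_abs.trans (le_trans ?_ hgε)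
    refine integral_mono_ae (integrable_mul_of_abs_le_one hf (hhi.sub hgi)).abs
      (hhi.sub hgi).abs ?_
    filter_upwards [hf] with z hz
    rw [abs_mul]
    exact mul_le_of_le_one_left (abs_nonneg _) hz
  rw [hsplit]
  linarith [abs_add_le (∫ z, f z * g z ∂P.prod P) (∫ z, f z * (h z - g z) ∂P.prod P), K f hf]

lemma indicator_prod {S T : Set Ω} (hS : MeasurableSet S) (hT : MeasurableSet T) :
    CutControlled P ((S ×ˢ T).indicator fun _ => 1) := by
  intro ε hε
  refine ⟨1, zero_le_one, fun f _ => ?_⟩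
  have : (fun z => f z * (S ×ˢ T).indicator (fun _ => (1 : ℝ)) z) = (S ×ˢ T).indicator f := by
    ext z
    by_cases hz : z ∈ S ×ˢ T <;> simp [hz]
  rw [this, integral_indicator (hS.prod hT)]
  linarith [le_cutNorm f hS hT]

variable [IsFiniteMeasure P]

lemma indicator {A : Set (Ω × Ω)} (hA : MeasurableSet A) :
    CutControlled P (A.indicator fun _ => 1) := by
  have hint : ∀ {B : Set (Ω × Ω)}, MeasurableSet B →
      Integrable (B.indicator fun _ => (1 : ℝ)) (P.prod P) :=
    fun hB => (integrable_const 1).indicator hB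
  induction A, hA using MeasurableSpace.induction_on_inter generateFrom_prod.symm isPiSystem_prod
    with
  | empty => simpa using indicator_prod (P := P) (S := ∅) (T := ∅) .empty .empty
  | basic A hA =>
    obtain ⟨S, hS, T, hT, rfl⟩ := hA
    exact indicator_prod hS hT
  | compl A hA ih =>
    have huniv : CutControlled P ((univ : Set (Ω × Ω)).indicator fun _ => (1 : ℝ)) := by
      simpa using indicator_prod (P := P) (S := univ) (T := univ) .univ .univ
    refine (huniv.add (ih.const_mul (-1)) (hint .univ) ((hint hA).const_mul (-1))).congr
      (Eventually.of_forall fun z => ?_)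
    by_cases hz : z ∈ A <;> simp [hz]
  | iUnion A hd hA ih =>
    refine of_approx (hint (.iUnion hA)) fun ε hε => ?_
    have hfin : ∀ n : ℕ,
        CutControlled P ((⋃ i ∈ Finset.range n, A i).indicator fun _ => (1 : ℝ)) := by
      intro n
      induction n with
      | zero => simpa using indicator_prod (P := P) (S := ∅) (T := ∅) .empty .empty
      | succ n ihn =>
        refine ((ih n).add ihn (hint (hA n))
          (hint (Finset.measurableSet_biUnion _ fun i _ => hA i))).congr
          (Eventually.of_forall fun z => ?_)
        rw [Finset.range_add_one, Finset.set_biUnion_insert, indicator_union_of_disjoint]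
        · rfl
        · refine disjoint_iUnion₂_right.2 fun i hi => hd ?_
          have := Finset.mem_range.1 hi
          omega
    have hlim : Tendsto (fun n : ℕ => ∫ z, |(⋃ i, A i).indicator (fun _ => (1 : ℝ)) z
        - (⋃ i ∈ Finset.range n, A i).indicator (fun _ => (1 : ℝ)) z| ∂P.prod P)
        atTop (𝓝 (∫ _, 0 ∂P.prod P)) := by
      refine tendsto_integral_of_dominated_convergence (fun _ => 1) (fun n => ?_)
        (integrable_const 1) (fun n => Eventually.of_forall fun z => ?_)
        (Eventually.of_forall fun z => ?_)
      · exact ((hint (.iUnion hA)).sub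
          (hint (Finset.measurableSet_biUnion _ fun i _ => hA i))).abs.aestronglyMeasurable
      · by_cases h₁ : z ∈ ⋃ i, A i <;> by_cases h₂ : z ∈ ⋃ i ∈ Finset.range n, A i <;>
          simp only [indicator_of_mem, indicator_of_notMem, h₁, h₂, not_false_eq_true] <;> simp
      · have h := ((tendsto_indicator_biUnion_finset A (fun _ => (1 : ℝ)) z).mono_right
          (pure_le_nhds _)).comp tendsto_finset_range
        simpa using (h.const_sub ((⋃ i, A i).indicator (fun _ => (1 : ℝ)) z)).abs
    rw [integral_zero] at hlim
    obtain ⟨n, hn⟩ := (hlim.eventually_lt_const hε).exists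
    exact ⟨_, hint (Finset.measurableSet_biUnion _ fun i _ => hA i), hfin n, hn.le⟩

/-- Every integrable kernel is cut-controlled: rectangles are by definition of the cut norm, and
the property passes to the generated `σ`-algebra, to linear combinations and to `L¹`-limits. -/
lemma of_integrable (hhi : Integrable h (P.prod P)) : CutControlled P h := by
  refine Integrable.induction (CutControlled P) ?_ ?_ ?_ ?_ hhi
  · intro c A hA _
    refine ((indicator hA).const_mul c).congr (Eventually.of_forall fun z => ?_)
    by_cases hz : z ∈ A <;> simp [hz]
  · intro f g _ hf hg hf' hg'
    exact hf'.add hg' hf hg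
  · refine isClosed_of_closure_subset fun f hf =>
      of_approx (L1.integrable_coeFn f) fun ε hε => ?_
    obtain ⟨g, hg, hfg⟩ := Metric.mem_closure_iff.1 hf ε hε
    refine ⟨g, L1.integrable_coeFn g, hg, le_of_eq_of_le ?_ hfg.le⟩
    rw [L1.dist_eq_integral_dist]
    rfl
  · intro f g hfg _ hf
    exact hf.congr hfg

end CutControlled

/-! ### Weak isomorphy and the `L¹`-distance of orbits -/

section

variable [IsFiniteMeasure P]

lemma integral_mul_pullback (ψ : MPAut P) (f g : Lp ℝ 1 (P.prod P)) :
    ∫ z, f z * pullback ψ g z ∂P.prod P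
      = ∫ z, pullback (mpSymm ψ) f z * g z ∂P.prod P := by
  rw [← (measurePreserving_prodMap ψ).integral_comp (ψ.1.prodCongr ψ.1).measurableEmbedding
    fun z => pullback (mpSymm ψ) f z * g z]
  refine integral_congr_ae ?_
  have h := (measurePreserving_prodMap ψ).quasiMeasurePreserving.ae
    (coeFn_pullback (mpSymm ψ) f)
  filter_upwards [coeFn_pullback ψ g, h] with z h₁ h₂
  rw [h₁, h₂]
  simp only [Function.comp_apply, Prod.map, mpSymm, MeasurableEquiv.symm_apply_apply]

lemma ae_pullback {p : ℝ → Prop} (ψ : MPAut P) {f : Lp ℝ 1 (P.prod P)}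
    (hf : ∀ᵐ z ∂P.prod P, p (f z)) : ∀ᵐ z ∂P.prod P, p (pullback ψ f z) := by
  filter_upwards [coeFn_pullback ψ f, (measurePreserving_prodMap ψ).quasiMeasurePreserving.ae hf]
    with z h₁ h₂
  rw [h₁]
  exact h₂

lemma pullback_mem_graphonSet (ψ : MPAut P) (w : Graphon P) :
    pullback ψ w.1 ∈ graphonSet P := by
  obtain ⟨g, hg, hsymm, hIcc, h⟩ := w.2
  refine ⟨g ∘ Prod.map ψ.1 ψ.1, hg.comp (ψ.1.measurable.prodMap ψ.1.measurable),
    fun x y => hsymm _ _, fun z => hIcc _, ?_⟩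
  exact (coeFn_pullback ψ w.1).trans
    ((measurePreserving_prodMap ψ).quasiMeasurePreserving.ae_eq_comp h)

lemma dist_pullback_pullback (ψ : MPAut P) (f g : Lp ℝ 1 (P.prod P)) :
    dist (pullback ψ f) (pullback ψ g) = dist f g :=
  (Lp.isometry_compMeasurePreserving (measurePreserving_prodMap ψ)).dist_eq f g

lemma mk_pullback (ψ : MPAut P) (w : Graphon P) :
    GraphonClass.mk ⟨pullback ψ w.1, pullback_mem_graphonSet ψ w⟩ = GraphonClass.mk w := by
  refine (Quotient.sound (s := weakIso P) (le_antisymm ?_ (cutDist_nonneg _ _))).symm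
  refine (cutDist_le _ _ ψ).trans (le_of_eq ?_)
  rw [sub_self, cutNorm_zero]

end

/-- If `δ□(w, w') = 0`, then `w` has rearrangements that are arbitrarily close to `w'` in `L¹`.
For `f = w^ψ - w'` one has `∫ f² = ∫ f^{ψ⁻¹} w - ∫ f w'`, where both terms are controlled by
`‖f‖□` with constants that depend on `w` and `w'` but not on `ψ`. -/
theorem exists_dist_pullback_lt [IsProbabilityMeasure P] {w w' : Graphon P}
    (h : cutDist w w' = 0) {ε : ℝ} (hε : 0 < ε) :
    ∃ ψ : MPAut P, dist (pullback ψ w.1) w'.1 < ε := by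
  obtain ⟨C, hC, H⟩ := CutControlled.of_integrable (L1.integrable_coeFn w.1) (ε ^ 2 / 16)
    (by positivity)
  obtain ⟨D, hD, K⟩ := CutControlled.of_integrable (L1.integrable_coeFn w'.1) (ε ^ 2 / 16)
    (by positivity)
  obtain ⟨ψ, hψ⟩ := exists_lt_of_ciInf_lt
    (show ⨅ ψ : MPAut P, cutNorm (pullback ψ w.1 - w'.1) < ε ^ 2 / (16 * (C + D + 1)) from
      lt_of_eq_of_lt h (by positivity))
  refine ⟨ψ, ?_⟩
  set f := pullback ψ w.1 - w'.1 with hf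
  have hsub := Lp.coeFn_sub (pullback ψ w.1) w'.1
  have hf1 : ∀ᵐ z ∂P.prod P, |f z| ≤ 1 := by
    filter_upwards [hsub, ae_pullback ψ (ae_mem_Icc w), ae_mem_Icc w'] with z h₁ h₂ h₃
    rw [hf, h₁, Pi.sub_apply, abs_le]
    constructor <;> linarith [h₂.1, h₂.2, h₃.1, h₃.2]
  have hfi : Integrable f (P.prod P) := L1.integrable_coeFn f
  have hfC : (C + D) * cutNorm f ≤ ε ^ 2 / 16 := by
    have h₁ := (lt_div_iff₀ (show 0 < 16 * (C + D + 1) by positivity)).1 hψ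
    nlinarith [cutNorm_nonneg f]
  have hw : |∫ z, f z * pullback ψ w.1 z ∂P.prod P| ≤ C * cutNorm f + ε ^ 2 / 16 := by
    rw [integral_mul_pullback]
    exact (H _ (ae_pullback (p := fun r => |r| ≤ 1) _ hf1)).trans
      (add_le_add_left (mul_le_mul_of_nonneg_left (cutNorm_pullback_le _ _) hC) _)
  have hsq : ∫ z, f z * f z ∂P.prod P
      = (∫ z, f z * pullback ψ w.1 z ∂P.prod P) - ∫ z, f z * w'.1 z ∂P.prod P := by
    rw [← integral_sub (integrable_mul_of_abs_le_one hf1 (L1.integrable_coeFn _))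
      (integrable_mul_of_abs_le_one hf1 (L1.integrable_coeFn _))]
    refine integral_congr_ae ?_
    filter_upwards [hsub] with z hz
    rw [hf, ← mul_sub, hz, Pi.sub_apply]
  have hsq_le : ∫ z, f z * f z ∂P.prod P ≤ 3 * ε ^ 2 / 16 := by
    rw [hsq]
    linarith [(abs_le.1 hw).2, (abs_le.1 (K f hf1)).1]
  -- `ε |f| ≤ f² + ε² / 4` turns the bound on `∫ f²` into one on `∫ |f|`.
  have hnorm : ε * ∫ z, |f z| ∂P.prod P ≤ (∫ z, f z * f z ∂P.prod P) + ε ^ 2 / 4 := by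
    have hconst : ∫ _, ε ^ 2 / 4 ∂P.prod P = ε ^ 2 / 4 := by simp
    rw [← hconst, ← integral_const_mul, ← integral_add
      (integrable_mul_of_abs_le_one hf1 hfi) (integrable_const _)]
    refine integral_mono (hfi.abs.const_mul ε)
      ((integrable_mul_of_abs_le_one hf1 hfi).add (integrable_const _)) fun z => ?_
    change ε * |f z| ≤ f z * f z + ε ^ 2 / 4
    nlinarith [sq_nonneg (|f z| - ε / 2), abs_mul_abs_self (f z)]
  have hdist : dist (pullback ψ w.1) w'.1 = ∫ z, |f z| ∂P.prod P := by
    rw [_root_.dist_eq_norm, L1.norm_eq_integral_norm]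
    rfl
  rw [hdist]
  nlinarith

end Graphon

/-! ### The quotient map -/

namespace GraphonClass

open Graphon

variable {Ω : Type*} [MeasurableSpace Ω] {P : Measure Ω}

lemma surjective_mk [SFinite P] : Function.Surjective (mk : Graphon P → GraphonClass P) :=
  Quotient.mk_surjective

lemma continuous_mk [SFinite P] : Continuous (mk : Graphon P → GraphonClass P) := by
  refine (LipschitzWith.of_dist_le_mul (K := 1) fun w w' => ?_).continuous
  rw [NNReal.coe_one, one_mul, Subtype.dist_eq, _root_.dist_eq_norm]
  have h := cutDist_le w w' (mpId P)
  rw [pullback_id] at h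
  exact h.trans (cutNorm_le_norm _)

/-- The weak isomorphy saturation of a ball is a union of translates of the ball. -/
lemma isOpen_preimage_image_ball [IsProbabilityMeasure P] (x : Graphon P) (r : ℝ) :
    IsOpen {w : Graphon P | ∃ p ∈ (mk w).eqvClass, dist x p < r} := by
  have : {w : Graphon P | ∃ p ∈ (mk w).eqvClass, dist x p < r}
      = ⋃ ψ : MPAut P, {w | dist (pullback ψ x.1) w.1 < r} := by
    ext w
    simp only [mem_ofPred_eq, mem_iUnion]
    constructor
    · rintro ⟨p, hp, hxp⟩
      obtain ⟨ψ, hψ⟩ := exists_dist_pullback_lt (Quotient.exact (s := weakIso P) hp)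
        (sub_pos.2 hxp)
      refine ⟨ψ, ?_⟩
      have h₁ := dist_triangle (pullback ψ x.1) (pullback ψ p.1) w.1
      rw [dist_pullback_pullback] at h₁
      have h₂ : dist x p = dist x.1 p.1 := rfl
      linarith
    · rintro ⟨ψ, hψ⟩
      refine ⟨⟨_, pullback_mem_graphonSet (mpSymm ψ) w⟩, mk_pullback _ _, ?_⟩
      rw [Subtype.dist_eq, ← dist_pullback_pullback ψ, pullback_symm_pullback]
      exact hψ
  rw [this]
  exact isOpen_iUnion fun ψ => isOpen_lt (continuous_const.dist continuous_subtype_val)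
    continuous_const

end GraphonClass

theorem theorem1 {Ω : Type*} [MeasurableSpace Ω] [StandardBorelSpace Ω]
    (P : Measure Ω) [IsProbabilityMeasure P] [NullSingletonClass P] :
    (∃ ξ : ℕ → GraphonClass P → Graphon P,
      (∀ n, Measurable (ξ n)) ∧
      ∀ c : GraphonClass P,
        range (fun n => ξ n c) ⊆ c.eqvClass ∧
        c.eqvClass ⊆ closure (range (fun n => ξ n c))) ∧
    (∃ ξ : GraphonClass P → Graphon P,
      Measurable ξ ∧ ∀ c : GraphonClass P, ξ c ∈ c.eqvClass) := by
  have : SecondCountableTopology (GraphonClass P) :=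
    have : TopologicalSpace.SeparableSpace (GraphonClass P) :=
      GraphonClass.surjective_mk.denseRange.separableSpace GraphonClass.continuous_mk
    UniformSpace.secondCountable_of_separable _
  obtain ⟨ξ, hξ, h⟩ := exists_seq_measurable_selection
    (F := fun c : GraphonClass P => c.eqvClass)
    (fun c => isClosed_singleton.preimage GraphonClass.continuous_mk)
    GraphonClass.surjective_mk
    -- Measurability descends along the quotient map because `Graphon P` is standard Borel.
    (fun x r => (GraphonClass.continuous_mk.measurable.measurableSet_preimage_iff_of_surjective
      GraphonClass.surjective_mk).1 (GraphonClass.isOpen_preimage_image_ball x r).measurableSet)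
  exact ⟨⟨ξ, hξ, h⟩, ξ 0, hξ 0, fun c => (h c).1 ⟨0, rfl⟩⟩
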